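/- Consider structures with binary relations $E$ and $C_i$ ($i\in\omega$). Let $K$ be the class of finite structures in which $E$ is an equivalence relation, the $C_i$ colour the unordered pairs of distinct elements (each $C_i$ is symmetric and irreflexive, and every pair of distinct elements lies in exactly one $C_i$), and there are no monochromatic triangles (no $i,x,y,z$ with $xC_iy$, $yC_iz$ and $zC_ix$). Let $\mathcal{M}$ be the (countable) Fraïssé limit of $K$. Let $\omega_1^{CK}$ be the least non-computable ordinal and $\omega_1^{CK}(1+\eta)$ the Harrison order type, $\eta$ being the order type of $\mathbb{Q}$. Let $\mathcal{N}$ be an expansion of $\mathcal{M}$ by a binary relation $\le$ that orders the $E$-classes linearly in order type $\omega_1^{CK}(1+\eta)$; that is, there is a map $R$ from $\mathcal{M}$ onto $\omega_1^{CK}(1+\eta)$ with $R(x)=R(y)\iff xEy$, and $x\le y$ in $\mathcal{N}$ if and only if $R(x)\le R(y)$. An indiscernible sequence of imaginaries of a structure $\mathcal{A}$ is a sequence $(X_i)_{i\in\omega}$ of distinct equivalence classes of some (parameter-free) $L_{\omega_1\omega}$-definable equivalence relation on $\mathcal{A}$ such that for all $i_1<\dots<i_n$ and $j_1<\dots<j_n$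 there is an automorphism of $\mathcal{A}$ mapping $X_{i_k}$ onto $X_{j_k}$ for $k=1,\dots,n$. Proposition. (1) Every permutation of the $E$-classes of $\mathcal{M}$ extends to an automorphism of $\mathcal{M}$: for each permutation $\pi$ there is an automorphism $f$ of $\mathcal{M}$ with $f(X)=\pi(X)$ for every $E$-class $X$. (2) Every automorphism $g$ of $\omega_1^{CK}(1+\eta)$ is induced by an automorphism $f$ of $\mathcal{N}$, i.e. $R(f(x))=g(R(x))$ for all $x$. (3) $\mathcal{N}$ has an indiscernible sequence of imaginaries; indeed it has one that consists of $E$-classes. -/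

import Mathlib

open scoped FirstOrder

universe u v w

/-! ### The infinitary logic `L_{ω₁ω}` and imaginaries -/

/-- Formulas of `L_{ω₁ω}` whose free variables are among `x₀, …, xₙ₋₁`: closed under negation,
countable conjunction and universal quantification (of the new variable `xₙ`). -/
inductive InfFormula (L : FirstOrder.Language.{u, v}) : ℕ → Type (max u v)
  | equal {n : ℕ} (t₁ t₂ : L.Term (Fin n)) : InfFormula L n
  | rel {n l : ℕ} (r : L.Relations l) (ts : Fin l → L.Term (Fin n)) : InfFormula L n
  | neg {n : ℕ} (φ : InfFormula L n) : InfFormula L n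
  | conj {n : ℕ} (φ : ℕ → InfFormula L n) : InfFormula L n
  | all {n : ℕ} (φ : InfFormula L (n + 1)) : InfFormula L n

/-- Satisfaction of an `L_{ω₁ω}` formula by a tuple in a structure. -/
def InfFormula.Realize {L : FirstOrder.Language.{u, v}} {A : Type w} [L.Structure A] :
    {n : ℕ} → InfFormula L n → (Fin n → A) → Prop
  | _, .equal t₁ t₂, x => t₁.realize x = t₂.realize x
  | _, .rel r ts, x => FirstOrder.Language.Structure.RelMap r (fun i => (ts i).realize x)
  | _, .neg φ, x => ¬ φ.Realize x
  | _, .conj φ, x => ∀ k, (φ k).Realize x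
  | _, .all φ, x => ∀ a : A, φ.Realize (Fin.snoc x a)

/-- A binary relation on a structure is `L_{ω₁ω}`-definable (without parameters). -/
def IsInfDefinable (L : FirstOrder.Language.{u, v}) {A : Type w} [L.Structure A] (r : A → A → Prop) : Prop :=
  ∃ φ : InfFormula L 2, ∀ x y : A, r x y ↔ φ.Realize ![x, y]

/-- `X 0, X 1, …` is an indiscernible sequence of imaginaries of `A`: a sequence of distinct
classes of the `L_{ω₁ω}`-definable equivalence relation `r` such that any two finite increasing
subsequences of equal length are conjugate under an automorphism of `A`. -/
structure IsIndiscernibleSeqOfImaginaries (L : FirstOrder.Language.{u, v}) {A : Type w} [L.Structure A]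
    (r : A → A → Prop) (X : ℕ → Set A) : Prop where
  equivalence : Equivalence r
  definable : IsInfDefinable L r
  isClass : ∀ i, ∃ a : A, X i = {b | r a b}
  injective : Function.Injective X
  conjugate : ∀ (n : ℕ) (i j : Fin n → ℕ), StrictMono i → StrictMono j →
    ∃ f : A ≃[L] A, ∀ k, f '' X (i k) = X (j k)

/-! ### The class `K` -/

/-- Relation symbols: a binary `E` and binary colours `C₀, C₁, …`. -/
inductive ColorRel : ℕ → Type
  | E : ColorRel 2
  | C (i : ℕ) : ColorRel 2

/-- The relational language `{E, C₀, C₁, …}`. -/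
def colorLang : FirstOrder.Language.{0, 0} := ⟨fun _ => Empty, ColorRel⟩

instance : colorLang.IsRelational := fun _ => inferInstanceAs (IsEmpty Empty)

/-- The relation `E` of a structure. -/
def relE {A : Type w} [colorLang.Structure A] (x y : A) : Prop :=
  FirstOrder.Language.Structure.RelMap (L := colorLang) ColorRel.E ![x, y]

/-- The relation `Cᵢ` of a structure. -/
def relC {A : Type w} [colorLang.Structure A] (i : ℕ) (x y : A) : Prop :=
  FirstOrder.Language.Structure.RelMap (L := colorLang) (ColorRel.C i) ![x, y]

/-- `E` is an equivalence relation, and the `Cᵢ` colour the unordered pairs of distinct elements,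
exactly one colour for each pair, without monochromatic triangles. -/
structure IsColored (A : Type w) [colorLang.Structure A] : Prop where
  equivalence : Equivalence (relE (A := A))
  irrefl : ∀ (i : ℕ) (x : A), ¬ relC i x x
  symm : ∀ (i : ℕ) (x y : A), relC i x y → relC i y x
  existsUnique : ∀ x y : A, x ≠ y → ∃! i, relC i x y
  noTriangle : ∀ (i : ℕ) (x y z : A), ¬ (relC i x y ∧ relC i y z ∧ relC i z x)

/-- The class `K` of finite coloured structures. -/
def classK : Set (CategoryTheory.Bundled.{w} colorLang.Structure) :=
  {A | Finite A ∧ IsColored A}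

/-- The `E`-class of an element. -/
def classE {A : Type w} [colorLang.Structure A] (a : A) : Set A := {b | relE a b}

/-! ### The Harrison ordering -/

/-- An ordinal is computable if it is the order type of a computable well-ordering of a computable
set of natural numbers. -/
def IsComputableOrdinal (α : Ordinal.{0}) : Prop :=
  ∃ (D : ℕ → Prop) (r : ℕ → ℕ → Prop),
    ComputablePred D ∧ ComputablePred (fun p : ℕ × ℕ => r p.1 p.2) ∧
    ∃ _ : IsWellOrder {n : ℕ // D n} (fun a b => r a b),
      Ordinal.type (fun a b : {n : ℕ // D n} => r a b) = α

/-- `ω₁^{CK}`, the least ordinal that is not computable. -/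
noncomputable def omega1CK : Ordinal.{0} := sInf {α | ¬ IsComputableOrdinal α}

/-- The linear order `ω₁^{CK}(1 + η)`: copies of `ω₁^{CK}` placed one after the other along
`1 + η`, where `η` is the order type of the rationals. -/
abbrev HarrisonOrder : Type := (Unit ⊕ₗ ℚ) ×ₗ omega1CK.ToType

/-! ### The expansion by an ordering of the classes -/

/-- The language `{E, C₀, C₁, …, ≤}`. -/
abbrev colorOrderLang : FirstOrder.Language.{0, 0} := colorLang.sum FirstOrder.Language.order

/-- The set `M`, to be expanded by the ordering that a map `R` to the Harrison ordering induces. -/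
def HarrisonExpansion {M : Type w} (_R : M → HarrisonOrder) : Type w := M

instance {M : Type w} [S : colorLang.Structure M] (R : M → HarrisonOrder) :
    colorLang.Structure (HarrisonExpansion R) := S

/-- `x ≤ y` holds if and only if `R x ≤ R y`. -/
instance {M : Type w} (R : M → HarrisonOrder) : LE (HarrisonExpansion R) :=
  ⟨fun x y : M => R x ≤ R y⟩

/-- The symbol `≤` is interpreted by the relation `≤`. Together with the previous instances this
makes `HarrisonExpansion R` a structure for `colorOrderLang`. -/
instance {M : Type w} (R : M → HarrisonOrder) : FirstOrder.Language.order.Structure (HarrisonExpansion R) :=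
  FirstOrder.Language.orderStructure (HarrisonExpansion R)

/-! ### Back and forth -/

/-! The colours, not the classes, carry the constraint: forbidding monochromatic triangles says
nothing about `E`. So over a finite set every triangle-free assignment of colours is realised by a
point in any prescribed class (`exists_onePoint`). Hence a finite partial map that preserves colours
and moves classes by a fixed permutation can always be extended, and back and forth makes it an
automorphism (`exists_automorphism_of_perm`). An automorphism of the order of the classes is such a
permutation. For indiscernibles, fix a position `o` in `ω₁^{CK}` and take the classes at `o` in the
copies indexed by the rationals 0, 1, 2, …. Finite increasing sequences in `ℚ` are conjugate, and
automorphisms of `ℚ` lift to the Harrison ordering. -/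

/-- The back-and-forth method for finite relations all of whose pairs of elements satisfy `Q`. -/
theorem exists_equiv_of_back_and_forth {α : Type v} {β : Type w} [Countable α] [Countable β]
    (Q : α × β → α × β → Prop) (hQ : ∀ p q, Q p q → (p.1 = q.1 ↔ p.2 = q.2))
    (forth : ∀ s : Finset (α × β), (∀ p ∈ s, ∀ q ∈ s, Q p q) → ∀ a, ∃ t : Finset (α × β),
      s ⊆ t ∧ (∀ p ∈ t, ∀ q ∈ t, Q p q) ∧ ∃ b, (a, b) ∈ t)
    (back : ∀ s : Finset (α × β), (∀ p ∈ s, ∀ q ∈ s, Q p q) → ∀ b, ∃ t : Finset (α × β),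
      s ⊆ t ∧ (∀ p ∈ t, ∀ q ∈ t, Q p q) ∧ ∃ a, (a, b) ∈ t)
    (s₀ : Finset (α × β)) (hs₀ : ∀ p ∈ s₀, ∀ q ∈ s₀, Q p q) :
    ∃ f : α ≃ β, (∀ p ∈ s₀, f p.1 = p.2) ∧ ∀ x y, Q (x, f x) (y, f y) := by
  cases nonempty_encodable α
  cases nonempty_encodable β
  let T := {s : Finset (α × β) // ∀ p ∈ s, ∀ q ∈ s, Q p q}
  let dom (a : α) : Order.Cofinal T :=
    { carrier := {s | ∃ b, (a, b) ∈ s.1}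
      isCofinal := fun s ↦ by
        obtain ⟨t, hst, ht, hb⟩ := forth s.1 s.2 a
        exact ⟨⟨t, ht⟩, hb, hst⟩ }
  let cod (b : β) : Order.Cofinal T :=
    { carrier := {s | ∃ a, (a, b) ∈ s.1}
      isCofinal := fun s ↦ by
        obtain ⟨t, hst, ht, ha⟩ := back s.1 s.2 b
        exact ⟨⟨t, ht⟩, ha, hst⟩ }
  let 𝒟 : α ⊕ β → Order.Cofinal T := Sum.elim dom cod
  -- Directedness puts any two pairs of the generic ideal into a common member, so `Q` holds
  -- throughout its union.
  let I : Order.Ideal T := Order.idealOfCofinals ⟨s₀, hs₀⟩ 𝒟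
  have hI : ∀ p q : α × β, (∃ s ∈ I, p ∈ s.1) → (∃ s ∈ I, q ∈ s.1) → Q p q := by
    rintro p q ⟨s, hs, hp⟩ ⟨t, ht, hq⟩
    obtain ⟨m, -, hsm, htm⟩ := I.directed s hs t ht
    exact m.2 _ (hsm hp) _ (htm hq)
  have hdom : ∀ a, ∃ b, ∃ s ∈ I, (a, b) ∈ s.1 := fun a ↦ by
    obtain ⟨s, ⟨b, hb⟩, hs⟩ := Order.cofinal_meets_idealOfCofinals ⟨s₀, hs₀⟩ 𝒟 (Sum.inl a)
    exact ⟨b, s, hs, hb⟩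
  have hcod : ∀ b, ∃ a, ∃ s ∈ I, (a, b) ∈ s.1 := fun b ↦ by
    obtain ⟨s, ⟨a, ha⟩, hs⟩ := Order.cofinal_meets_idealOfCofinals ⟨s₀, hs₀⟩ 𝒟 (Sum.inr b)
    exact ⟨a, s, hs, ha⟩
  choose f hf using hdom
  choose g hg using hcod
  refine ⟨⟨f, g, fun a ↦ (hQ _ _ (hI _ _ (hg (f a)) (hf a))).2 rfl,
    fun b ↦ (hQ _ _ (hI _ _ (hf (g b)) (hg b))).1 rfl⟩, fun p hp ↦ ?_,
    fun x y ↦ hI _ _ (hf x) (hf y)⟩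
  exact (hQ _ _ (hI _ _ (hf p.1) ⟨_, Order.mem_idealOfCofinals ⟨s₀, hs₀⟩ 𝒟, hp⟩)).1 rfl

/-- Finite strictly increasing sequences of equal length in a countable dense linear order without
endpoints are conjugate. -/
theorem exists_orderIso_of_strictMono {α : Type v} [LinearOrder α] [Countable α] [DenselyOrdered α]
    [NoMinOrder α] [NoMaxOrder α] [Nonempty α] {n : ℕ} {i j : Fin n → α} (hi : StrictMono i)
    (hj : StrictMono j) : ∃ e : α ≃o α, ∀ k, e (i k) = j k := by
  classical
  obtain ⟨f, hf₀, hf⟩ := exists_equiv_of_back_and_forth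
    -- This is the condition that defines `Order.PartialIso`, whose extension lemmas then apply.
    (fun p q : α × α ↦ cmp p.1 q.1 = cmp p.2 q.2)
    (fun p q h ↦ by rw [← cmp_eq_eq_iff, h, cmp_eq_eq_iff])
    (fun s hs a ↦ by
      obtain ⟨t, hb, hst⟩ := (Order.PartialIso.definedAtLeft α a).isCofinal ⟨s, hs⟩
      exact ⟨t.1, hst, t.2, hb⟩)
    (fun s hs b ↦ by
      obtain ⟨t, ha, hst⟩ := (Order.PartialIso.definedAtRight α b).isCofinal ⟨s, hs⟩
      exact ⟨t.1, hst, t.2, ha⟩)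
    (Finset.univ.image fun k ↦ (i k, j k))
    (by
      intro p hp q hq
      simp only [Finset.mem_image, Finset.mem_univ, true_and] at hp hq
      obtain ⟨k, rfl⟩ := hp
      obtain ⟨l, rfl⟩ := hq
      exact (hi.cmp_map_eq k l).trans (hj.cmp_map_eq k l).symm)
  refine ⟨⟨f, fun {x y} ↦ (le_iff_le_of_cmp_eq_cmp (hf x y)).symm⟩, fun k ↦ ?_⟩
  exact hf₀ (i k, j k) (Finset.mem_image_of_mem _ (Finset.mem_univ k))

/-! ### Coloured structures -/

/-- The extension of a coloured structure `A` by a new point, in the `E`-class of `c` and joined to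
each `x` by the colour `γ x`. -/
@[reducible]
def onePointStructure {A : Type w} [colorLang.Structure A] (c : A) (γ : A → ℕ) :
    colorLang.Structure (Option A) where
  funMap := fun f ↦ Empty.elim f
  RelMap := fun r ↦ match r with
    | .E => fun xs ↦ relE ((xs 0).getD c) ((xs 1).getD c)
    | .C i => fun xs ↦ match xs 0, xs 1 with
      | some x, some y => relC i x y
      | some x, none => γ x = i
      | none, some y => γ y = i
      | none, none => False

/-- A monochromatic triangle on the new point, `x` and `y` would need `γ x = γ y` to be the colour
of `x` and `y`. -/
theorem isColored_onePointStructure {A : Type w} [colorLang.Structure A] (hA : IsColored A)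
    (c : A) (γ : A → ℕ) (hγ : ∀ x y, relC (γ x) x y → γ x ≠ γ y) :
    @IsColored (Option A) (onePointStructure c γ) := by
  let := onePointStructure c γ
  have hγ' : ∀ i x y, γ x = i → relC i x y → γ y ≠ i := by
    rintro i x y rfl h h'
    exact hγ x y h h'.symm
  refine @IsColored.mk _ (onePointStructure c γ) ?_ ?_ ?_ ?_ ?_
  · exact ⟨fun x ↦ hA.equivalence.refl (x.getD c), fun {x y} h ↦ hA.equivalence.symm h,
      fun {x y z} h h' ↦ hA.equivalence.trans h h'⟩
  · rintro i (_ | x) h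
    exacts [h, hA.irrefl i x h]
  · rintro i (_ | x) (_ | y) h
    exacts [h, h, h, hA.symm i x y h]
  · rintro (_ | x) (_ | y) h
    · exact (h rfl).elim
    · exact ⟨γ y, rfl, fun _ h ↦ h.symm⟩
    · exact ⟨γ x, rfl, fun _ h ↦ h.symm⟩
    · exact hA.existsUnique x y fun h' ↦ h (congrArg some h')
  · rintro i (_ | x) (_ | y) (_ | z) ⟨h₁, h₂, h₃⟩
    · exact h₁
    · exact h₁
    · exact h₃
    · exact hγ' i y z h₁ h₂ h₃
    · exact h₂
    · exact hγ' i x z h₁ (hA.symm _ _ _ h₃) h₂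
    · exact hγ' i x y h₃ h₁ h₂
    · exact hA.noTriangle i x y z ⟨h₁, h₂, h₃⟩

theorem relMap_E_iff {A : Type w} [colorLang.Structure A] (xs : Fin 2 → A) :
    FirstOrder.Language.Structure.RelMap (L := colorLang) ColorRel.E xs ↔
      relE (xs 0) (xs 1) := by
  have : xs = ![xs 0, xs 1] := (FinVec.etaExpand_eq xs).symm
  exact iff_of_eq (congrArg (FirstOrder.Language.Structure.RelMap (L := colorLang) ColorRel.E) this)

theorem relMap_C_iff {A : Type w} [colorLang.Structure A] (i : ℕ) (xs : Fin 2 → A) :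
    FirstOrder.Language.Structure.RelMap (L := colorLang) (ColorRel.C i) xs ↔
      relC i (xs 0) (xs 1) := by
  have : xs = ![xs 0, xs 1] := (FinVec.etaExpand_eq xs).symm
  exact iff_of_eq
    (congrArg (FirstOrder.Language.Structure.RelMap (L := colorLang) (ColorRel.C i)) this)

theorem map_relE_iff {A : Type v} {B : Type w} [colorLang.Structure A] [colorLang.Structure B]
    (f : A ↪[colorLang] B) (x y : A) : relE (f x) (f y) ↔ relE x y :=
  (relMap_E_iff (f ∘ ![x, y])).symm.trans (f.map_rel _ _)

theorem map_relC_iff {A : Type v} {B : Type w} [colorLang.Structure A] [colorLang.Structure B]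
    (f : A ↪[colorLang] B) (i : ℕ) (x y : A) : relC i (f x) (f y) ↔ relC i x y :=
  (relMap_C_iff i (f ∘ ![x, y])).symm.trans (f.map_rel _ _)

/-- A bijection that respects all the relations is an isomorphism. -/
def colorEquiv {A : Type v} {B : Type w} [colorLang.Structure A] [colorLang.Structure B]
    (f : A ≃ B) (hE : ∀ x y, relE (f x) (f y) ↔ relE x y)
    (hC : ∀ i x y, relC i (f x) (f y) ↔ relC i x y) : A ≃[colorLang] B where
  toEquiv := f
  map_fun' := fun f ↦ Empty.elim f
  map_rel' := by
    rintro n (_ | i) xs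
    · exact (relMap_E_iff (f ∘ xs)).trans ((hE _ _).trans (relMap_E_iff xs).symm)
    · exact (relMap_C_iff i (f ∘ xs)).trans ((hC i _ _).trans (relMap_C_iff i xs).symm)

/-! ### The Fraïssé limit: extension property and permutations of the classes -/

section FraisseLimit

variable {M : Type u} [colorLang.Structure M] [Countable M]

/-- Each axiom involves at most three elements, and these generate a substructure in the age. -/
theorem isColored_of_isFraisseLimit (hM : FirstOrder.Language.IsFraisseLimit classK M) :
    IsColored M := by
  have key : ∀ x y z : M, ∃ S : colorLang.Substructure M, IsColored S ∧ x ∈ S ∧ y ∈ S ∧ z ∈ S := by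
    intro x y z
    let S := FirstOrder.Language.Substructure.closure colorLang ({x, y, z} : Set M)
    have hS : S.FG := FirstOrder.Language.Substructure.fg_closure (Set.toFinite _)
    have h := FirstOrder.Language.age.fg_substructure hS
    rw [hM.age] at h
    have hsub : ({x, y, z} : Set M) ⊆ S := FirstOrder.Language.Substructure.subset_closure
    exact ⟨S, h.2, hsub (by simp), hsub (by simp), hsub (by simp)⟩
  have hE : ∀ (S : colorLang.Substructure M) (x y : S), relE (x : M) y ↔ relE x y :=
    fun S ↦ map_relE_iff S.subtype
  have hC : ∀ (S : colorLang.Substructure M) (i : ℕ) (x y : S), relC i (x : M) y ↔ relC i x y :=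
    fun S ↦ map_relC_iff S.subtype
  refine ⟨⟨fun x ↦ ?_, fun {x y} h ↦ ?_, fun {x y z} h h' ↦ ?_⟩, fun i x h ↦ ?_, fun i x y h ↦ ?_,
    fun x y h ↦ ?_, fun i x y z ⟨h, h', h''⟩ ↦ ?_⟩
  · obtain ⟨S, hS, hx, -⟩ := key x x x
    exact (hE S ⟨x, hx⟩ ⟨x, hx⟩).2 (hS.equivalence.refl _)
  · obtain ⟨S, hS, hx, hy, -⟩ := key x y y
    exact (hE S ⟨y, hy⟩ ⟨x, hx⟩).2 (hS.equivalence.symm ((hE S ⟨x, hx⟩ ⟨y, hy⟩).1 h))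
  · obtain ⟨S, hS, hx, hy, hz⟩ := key x y z
    exact (hE S ⟨x, hx⟩ ⟨z, hz⟩).2 (hS.equivalence.trans ((hE S ⟨x, hx⟩ ⟨y, hy⟩).1 h)
      ((hE S ⟨y, hy⟩ ⟨z, hz⟩).1 h'))
  · obtain ⟨S, hS, hx, -⟩ := key x x x
    exact hS.irrefl i _ ((hC S i ⟨x, hx⟩ ⟨x, hx⟩).1 h)
  · obtain ⟨S, hS, hx, hy, -⟩ := key x y y
    exact (hC S i ⟨y, hy⟩ ⟨x, hx⟩).2 (hS.symm _ _ _ ((hC S i ⟨x, hx⟩ ⟨y, hy⟩).1 h))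
  · obtain ⟨S, hS, hx, hy, -⟩ := key x y y
    obtain ⟨i, hi, hu⟩ := hS.existsUnique ⟨x, hx⟩ ⟨y, hy⟩ fun h' ↦ h (congrArg Subtype.val h')
    exact ⟨i, (hC S i ⟨x, hx⟩ ⟨y, hy⟩).2 hi, fun k hk ↦ hu k ((hC S k ⟨x, hx⟩ ⟨y, hy⟩).1 hk)⟩
  · obtain ⟨S, hS, hx, hy, hz⟩ := key x y z
    exact hS.noTriangle i _ _ _ ⟨(hC S i ⟨x, hx⟩ ⟨y, hy⟩).1 h, (hC S i ⟨y, hy⟩ ⟨z, hz⟩).1 h',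
      (hC S i ⟨z, hz⟩ ⟨x, hx⟩).1 h''⟩

theorem nonempty_of_isFraisseLimit (hM : FirstOrder.Language.IsFraisseLimit classK M) :
    Nonempty M := by
  let T : colorLang.Structure PUnit.{u + 1} :=
    { funMap := fun f ↦ Empty.elim f
      RelMap := fun r ↦ match r with
        | .E => fun _ ↦ True
        | .C _ => fun _ ↦ False }
  have hT : (⟨PUnit, T⟩ : CategoryTheory.Bundled colorLang.Structure) ∈ colorLang.age M := by
    rw [hM.age]
    exact ⟨inferInstanceAs (Finite PUnit), ⟨fun _ ↦ trivial, fun _ ↦ trivial, fun _ _ ↦ trivial⟩,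
      fun _ _ h ↦ h, fun _ _ _ h ↦ h, fun _ _ h ↦ (h rfl).elim, fun _ _ _ _ h ↦ h.1⟩
  exact hT.2.map fun f ↦ f PUnit.unit

/-- The one-point extension of `s` lies in the age; by ultrahomogeneity it embeds over `s`. Having
`c` in `s` lets it name the class of the new point. -/
theorem exists_onePoint_of_mem (hM : FirstOrder.Language.IsFraisseLimit classK M) (s : Finset M)
    {c : M} (hc : c ∈ s) (γ : M → ℕ)
    (hγ : ∀ x ∈ s, ∀ y ∈ s, relC (γ x) x y → γ x ≠ γ y) :
    ∃ b, b ∉ s ∧ relE b c ∧ ∀ x ∈ s, relC (γ x) b x := by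
  let S := FirstOrder.Language.Substructure.closure colorLang (s : Set M)
  have hmem : ∀ x, x ∈ S ↔ x ∈ s := fun x ↦
    (FirstOrder.Language.Substructure.mem_closure_iff_of_isRelational _ _ _).trans Finset.mem_coe
  have hS : S.FG := FirstOrder.Language.Substructure.fg_closure s.finite_toSet
  have hSK := FirstOrder.Language.age.fg_substructure hS
  rw [hM.age] at hSK
  have : Finite S := hSK.1
  let c' : S := ⟨c, (hmem c).2 hc⟩
  let T := onePointStructure c' (fun x : S ↦ γ x)
  have hT : IsColored (Option S) := isColored_onePointStructure hSK.2 c' _ fun x y h ↦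
    hγ x ((hmem x).1 x.2) y ((hmem y).1 y.2) ((map_relC_iff S.subtype _ x y).2 h)
  have hage : (⟨Option S, T⟩ : CategoryTheory.Bundled colorLang.Structure) ∈ colorLang.age M := by
    rw [hM.age]
    exact ⟨inferInstanceAs (Finite (Option S)), hT⟩
  have : Nonempty (Option S ↪[colorLang] M) := hage.2
  let g : S ↪[colorLang] Option S :=
    { toFun := some
      inj' := Option.some_injective _
      map_fun' := fun f ↦ Empty.elim f
      map_rel' := by
        rintro n (_ | i) xs
        · exact (relMap_E_iff xs).symm
        · exact (relMap_C_iff i xs).symm }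
  obtain ⟨f, hf⟩ := hM.ultrahomogeneous.extend_embedding
    (FirstOrder.Language.Substructure.fg_iff_structure_fg S |>.1 hS) S.subtype g
  have hfx : ∀ x : S, f (some x) = x := fun x ↦ (DFunLike.congr_fun hf x).symm
  refine ⟨f none, fun h ↦ ?_, ?_, fun x hx ↦ ?_⟩
  · have := f.injective (hfx ⟨f none, (hmem _).2 h⟩)
    cases this
  · have := (map_relE_iff f none (some c')).2 (hSK.2.equivalence.refl c')
    rwa [hfx] at this
  · have := (map_relC_iff f (γ x) none (some ⟨x, (hmem x).2 hx⟩)).2 rfl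
    rwa [hfx] at this

/-- The extension property of the Fraïssé limit. -/
theorem exists_onePoint (hM : FirstOrder.Language.IsFraisseLimit classK M) (s : Finset M)
    (c : M) (γ : M → ℕ) (hγ : ∀ x ∈ s, ∀ y ∈ s, relC (γ x) x y → γ x ≠ γ y) :
    ∃ b, b ∉ s ∧ relE b c ∧ ∀ x ∈ s, relC (γ x) b x := by
  classical
  by_cases hc : c ∈ s
  · exact exists_onePoint_of_mem hM s hc γ hγ
  have hM' := isColored_of_isFraisseLimit hM
  -- Infinitely many colours: a fresh one for the edge to `c` creates no new monochromatic triangle.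
  obtain ⟨n, hn⟩ := Infinite.exists_notMem_finset (s.image γ)
  have hn' : ∀ x ∈ s, γ x ≠ n := fun x hx h ↦ hn (Finset.mem_image.2 ⟨x, hx, h⟩)
  have hne : ∀ x ∈ s, x ≠ c := fun x hx h ↦ hc (h ▸ hx)
  obtain ⟨b, hb, hbc, hb'⟩ := exists_onePoint_of_mem hM (insert c s) (Finset.mem_insert_self c s)
    (Function.update γ c n) (by
      intro x hx y hy h
      rcases Finset.mem_insert.1 hx with rfl | hx' <;> rcases Finset.mem_insert.1 hy with rfl | hy'
      · exact (hM'.irrefl _ _ h).elim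
      · simpa [hne y hy'] using (hn' y hy').symm
      · simpa [hne x hx'] using hn' x hx'
      · simp only [Function.update_of_ne (hne x hx'), Function.update_of_ne (hne y hy')] at h ⊢
        exact hγ x hx' y hy' h)
  refine ⟨b, fun h ↦ hb (Finset.mem_insert_of_mem h), hbc, fun x hx ↦ ?_⟩
  simpa [hne x hx] using hb' x (Finset.mem_insert_of_mem hx)

/-- The compatibility condition of the back-and-forth construction for a permutation `g` of the
classes. -/
def IsCompatible {ι : Type v} (R : M → ι) (g : ι → ι) (p q : M × M) : Prop :=
  (p.1 = q.1 ↔ p.2 = q.2) ∧ (∀ i, relC i p.1 q.1 ↔ relC i p.2 q.2) ∧ R p.2 = g (R p.1)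

/-- The image of `a` copies the colours from `a` to the domain of `s`; a monochromatic triangle so
created would pull back to one at `a`. -/
theorem exists_isCompatible_forth (hM : FirstOrder.Language.IsFraisseLimit classK M) {ι : Type v}
    {R : M → ι} (hR : Function.Surjective R) (hRE : ∀ x y : M, R x = R y ↔ relE x y)
    (g : Equiv.Perm ι) (s : Finset (M × M)) (hs : ∀ p ∈ s, ∀ q ∈ s, IsCompatible R g p q) (a : M) :
    ∃ t : Finset (M × M), s ⊆ t ∧ (∀ p ∈ t, ∀ q ∈ t, IsCompatible R g p q) ∧ ∃ b, (a, b) ∈ t := by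
  classical
  by_cases ha : ∃ b, (a, b) ∈ s
  · exact ⟨s, subset_rfl, hs, ha⟩
  have hM' := isColored_of_isFraisseLimit hM
  have hne : ∀ p ∈ s, a ≠ p.1 := by
    rintro ⟨_, b⟩ hp rfl
    exact ha ⟨b, hp⟩
  have hγ : ∀ y, ∃ n, ∀ x, (x, y) ∈ s → relC n a x := by
    intro y
    by_cases hy : ∃ x, (x, y) ∈ s
    · obtain ⟨x, hx⟩ := hy
      obtain ⟨n, hn, -⟩ := hM'.existsUnique a x (hne _ hx)
      refine ⟨n, fun x' hx' ↦ ?_⟩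
      rwa [show x' = x from (hs _ hx' _ hx).1.2 rfl]
    · exact ⟨0, fun x hx ↦ (hy ⟨x, hx⟩).elim⟩
  choose γ hγ using hγ
  obtain ⟨c, hc⟩ := hR (g (R a))
  obtain ⟨b, hb, hbc, hb'⟩ := exists_onePoint hM (s.image Prod.snd) c γ (by
    intro y hy y' hy' h h'
    obtain ⟨⟨x, _⟩, hx, rfl⟩ := Finset.mem_image.1 hy
    obtain ⟨⟨x', _⟩, hx', rfl⟩ := Finset.mem_image.1 hy'
    refine hM'.noTriangle _ a x x' ⟨hγ _ _ hx, ((hs _ hx _ hx').2.1 _).2 h, hM'.symm _ _ _ ?_⟩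
    rw [h']
    exact hγ _ _ hx')
  have hRb : R b = g (R a) := ((hRE b c).2 hbc).trans hc
  have hab : ∀ p ∈ s, (a = p.1 ↔ b = p.2) ∧ ∀ i, relC i a p.1 ↔ relC i b p.2 := by
    rintro ⟨x, y⟩ hp
    have hby : b ≠ y := by
      rintro rfl
      exact hb (Finset.mem_image_of_mem Prod.snd hp)
    have hax := hne _ hp
    have h₁ := hγ y x hp
    have h₂ := hb' y (Finset.mem_image_of_mem Prod.snd hp)
    refine ⟨iff_of_false hax hby, fun i ↦ ⟨fun h ↦ ?_, fun h ↦ ?_⟩⟩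
    · rwa [(hM'.existsUnique a x hax).unique h h₁]
    · rwa [(hM'.existsUnique b y hby).unique h h₂]
  have hcomm : ∀ i x y, relC i x y ↔ relC (A := M) i y x := fun i x y ↦
    ⟨hM'.symm i x y, hM'.symm i y x⟩
  refine ⟨insert (a, b) s, Finset.subset_insert _ _, fun p hp q hq ↦ ?_,
    b, Finset.mem_insert_self _ _⟩
  rcases Finset.mem_insert.1 hp with rfl | hp <;> rcases Finset.mem_insert.1 hq with rfl | hq
  · exact ⟨iff_of_true rfl rfl, fun i ↦ iff_of_false (hM'.irrefl i _) (hM'.irrefl i _), hRb⟩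
  · exact ⟨(hab q hq).1, (hab q hq).2, hRb⟩
  · refine ⟨?_, fun i ↦ ?_, (hs p hp p hp).2.2⟩
    · rw [eq_comm, (hab p hp).1, eq_comm]
    · rw [hcomm, (hab p hp).2, hcomm]
  · exact hs p hp q hq

/-- Forth for the inverse permutation, with all pairs swapped. -/
theorem exists_isCompatible_back (hM : FirstOrder.Language.IsFraisseLimit classK M) {ι : Type v}
    {R : M → ι} (hR : Function.Surjective R) (hRE : ∀ x y : M, R x = R y ↔ relE x y)
    (g : Equiv.Perm ι) (s : Finset (M × M)) (hs : ∀ p ∈ s, ∀ q ∈ s, IsCompatible R g p q) (b : M) :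
    ∃ t : Finset (M × M), s ⊆ t ∧ (∀ p ∈ t, ∀ q ∈ t, IsCompatible R g p q) ∧ ∃ a, (a, b) ∈ t := by
  classical
  have hswap : ∀ (h : Equiv.Perm ι) (p q : M × M), IsCompatible R h p q →
      IsCompatible R h.symm p.swap q.swap := fun h p q H ↦
    ⟨H.1.symm, fun i ↦ (H.2.1 i).symm, (h.symm_apply_eq.2 H.2.2).symm⟩
  have himage : ∀ (h : Equiv.Perm ι) (t : Finset (M × M)),
      (∀ p ∈ t, ∀ q ∈ t, IsCompatible R h p q) →
      ∀ p ∈ t.image Prod.swap, ∀ q ∈ t.image Prod.swap, IsCompatible R h.symm p q := by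
    intro h t ht p hp q hq
    obtain ⟨p, hp', rfl⟩ := Finset.mem_image.1 hp
    obtain ⟨q, hq', rfl⟩ := Finset.mem_image.1 hq
    exact hswap h p q (ht p hp' q hq')
  obtain ⟨t, hst, ht, a, ha⟩ := exists_isCompatible_forth hM hR hRE g.symm (s.image Prod.swap)
    (himage g s hs) b
  refine ⟨t.image Prod.swap, fun p hp ↦ ?_, himage g.symm t ht, a,
    Finset.mem_image.2 ⟨_, ha, rfl⟩⟩
  exact Finset.mem_image.2 ⟨p.swap, hst (Finset.mem_image_of_mem _ hp), p.swap_swap⟩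

/-- Every permutation of the classes, given as the fibres of a map `R`, is induced by an
automorphism. -/
theorem exists_automorphism_of_perm (hM : FirstOrder.Language.IsFraisseLimit classK M) {ι : Type v}
    {R : M → ι} (hR : Function.Surjective R) (hRE : ∀ x y : M, R x = R y ↔ relE x y)
    (g : Equiv.Perm ι) : ∃ f : M ≃[colorLang] M, ∀ x, R (f x) = g (R x) := by
  obtain ⟨f, -, hf⟩ := exists_equiv_of_back_and_forth (IsCompatible R g) (fun p q h ↦ h.1)
    (exists_isCompatible_forth hM hR hRE g) (exists_isCompatible_back hM hR hRE g) ∅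
    (fun p hp ↦ (Finset.notMem_empty p hp).elim)
  refine ⟨colorEquiv f (fun x y ↦ ?_) fun i x y ↦ ((hf x y).2.1 i).symm, fun x ↦ (hf x x).2.2⟩
  rw [← hRE, ← hRE, (hf x x).2.2, (hf y y).2.2, g.apply_eq_iff_eq]

end FraisseLimit

/-! ### The ordered expansion and the main theorem -/

/-- An automorphism that induces an order automorphism of the classes is an automorphism of the
expansion. -/
def harrisonExpansionEquiv {M : Type u} [colorLang.Structure M] {R : M → HarrisonOrder}
    (g : HarrisonOrder ≃o HarrisonOrder) (f : M ≃[colorLang] M) (hf : ∀ x, R (f x) = g (R x)) :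
    HarrisonExpansion R ≃[colorOrderLang] HarrisonExpansion R where
  toEquiv := f.toEquiv
  map_fun' := fun {n} F xs ↦ by
    rcases F with F | F <;> exact Empty.elim F
  map_rel' := by
    rintro n (r | r) xs
    · exact f.map_rel r xs
    · cases r
      have key : ∀ x y : M, R (f x) ≤ R (f y) ↔ R x ≤ R y := fun x y ↦ by
        rw [hf, hf, g.le_iff_le]
      exact key (xs 0) (xs 1)

theorem image_fiber_eq {M : Type u} {ι : Type v} {R : M → ι} {g : Equiv.Perm ι} {f : M ≃ M}
    (hf : ∀ x, R (f x) = g (R x)) {o o' : ι} (ho : g o = o') :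
    f '' {x | R x = o} = {x | R x = o'} := by
  subst ho
  ext y
  constructor
  · rintro ⟨x, rfl, rfl⟩
    exact hf x
  · intro hy
    refine ⟨f.symm y, g.injective ?_, f.apply_symm_apply y⟩
    rw [← hf, f.apply_symm_apply]
    exact hy

theorem isInfDefinable_relE {M : Type u} [colorLang.Structure M] (R : M → HarrisonOrder) :
    IsInfDefinable colorOrderLang (relE (A := HarrisonExpansion R)) := by
  refine ⟨.rel (Sum.inl ColorRel.E : colorOrderLang.Relations 2)
    (fun k ↦ FirstOrder.Language.Term.var k), fun x y ↦ Iff.rfl⟩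


theorem mainTheorem6 {M : Type u} [colorLang.Structure M] [Countable M]
    (hM : FirstOrder.Language.IsFraisseLimit classK M)
    (R : M → HarrisonOrder) (hR : Function.Surjective R)
    (hRE : ∀ x y : M, R x = R y ↔ relE x y) :
    -- every permutation of the `E`-classes extends to an automorphism of `M`
    (∀ π : Equiv.Perm (Set.range (classE (A := M))),
      ∃ f : M ≃[colorLang] M, ∀ X : Set.range (classE (A := M)),
        f '' (X : Set M) = (π X : Set M)) ∧
    -- every automorphism of the Harrison ordering is induced by an automorphism of `N`
    (∀ g : HarrisonOrder ≃o HarrisonOrder,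
      ∃ f : HarrisonExpansion R ≃[colorOrderLang] HarrisonExpansion R,
        ∀ x : M, R (f x) = g (R x)) ∧
    -- `N` has an indiscernible sequence of imaginaries, consisting of `E`-classes
    (∃ X : ℕ → Set (HarrisonExpansion R),
      IsIndiscernibleSeqOfImaginaries colorOrderLang (relE (A := HarrisonExpansion R)) X) := by
  have hM' := isColored_of_isFraisseLimit hM
  have part2 : ∀ g : HarrisonOrder ≃o HarrisonOrder,
      ∃ f : HarrisonExpansion R ≃[colorOrderLang] HarrisonExpansion R,
        ∀ x : M, R (f x) = g (R x) := fun g ↦ by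
    obtain ⟨f, hf⟩ := exists_automorphism_of_perm hM hR hRE g.toEquiv
    exact ⟨harrisonExpansionEquiv g f hf, hf⟩
  refine ⟨fun π ↦ ?_, part2, ?_⟩
  · let ρ : M → Set.range (classE (A := M)) := Set.rangeFactorization classE
    have hρE : ∀ x y, ρ x = ρ y ↔ relE x y := fun x y ↦ by
      rw [Subtype.ext_iff]
      constructor
      · intro h
        exact (Set.ext_iff.1 h y).2 (hM'.equivalence.refl y)
      · intro h
        ext z
        exact ⟨fun h' ↦ hM'.equivalence.trans (hM'.equivalence.symm h) h',
          fun h' ↦ hM'.equivalence.trans h h'⟩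
    have hfib : ∀ X : Set.range (classE (A := M)), (X : Set M) = {x | ρ x = X} := by
      rintro ⟨_, a, rfl⟩
      ext x
      exact ((hρE x a).trans ⟨hM'.equivalence.symm, hM'.equivalence.symm⟩).symm
    obtain ⟨f, hf⟩ := exists_automorphism_of_perm hM Set.rangeFactorization_surjective hρE π
    refine ⟨f, fun X ↦ ?_⟩
    rw [hfib X, hfib (π X)]
    exact image_fiber_eq (f := f.toEquiv) hf rfl
  -- Reading `o` off a value of `R` avoids any argument about computable ordinals.
  · obtain ⟨o⟩ : Nonempty omega1CK.ToType := (nonempty_of_isFraisseLimit hM).map fun a ↦ (ofLex (R a)).2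
    let p (q : ℚ) : HarrisonOrder := toLex (toLex (Sum.inr q), o)
    have hp : Function.Injective p := fun q q' h ↦
      Sum.inr_injective (toLex.injective (congrArg Prod.fst (toLex.injective h)))
    refine ⟨fun i ↦ {x : M | R x = p i}, hM'.equivalence, isInfDefinable_relE R, fun i ↦ ?_,
      fun i j h ↦ ?_, fun n i j hi hj ↦ ?_⟩
    · obtain ⟨a, ha⟩ := hR (p i)
      refine ⟨a, Set.ext fun x ↦ ?_⟩
      exact (ha ▸ eq_comm : R x = p i ↔ R a = R x).trans (hRE a x)
    · obtain ⟨a, ha⟩ := hR (p i)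
      have : R a = p j := (Set.ext_iff.1 h a).1 ha
      exact_mod_cast hp (ha.symm.trans this)
    · obtain ⟨e, he⟩ := exists_orderIso_of_strictMono (α := ℚ)
        (Nat.strictMono_cast.comp hi) (Nat.strictMono_cast.comp hj)
      -- The copies are moved by `e`; the first copy and all positions within copies stay fixed.
      let g : HarrisonOrder ≃o HarrisonOrder :=
        Prod.Lex.prodLexCongr (OrderIso.sumLexCongr (OrderIso.refl Unit) e) (OrderIso.refl _)
      obtain ⟨f, hf⟩ := part2 g
      refine ⟨f, fun k ↦ image_fiber_eq (f := f.toEquiv) (g := g.toEquiv) hf ?_⟩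
      exact congrArg p (he k)
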